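/- Let $A$ and $B$ be quantum systems with finite-dimensional complex Hilbert spaces $H_A,H_B$ and let $\alpha\in(0,1)$. A state is a positive operator of trace one. A channel $\Phi$ on a system is a map $\Phi(X)=\sum_i K_iXK_i^\dagger$ with finitely many Kraus operators $K_i$ satisfying $\sum_i K_i^\dagger K_i=I$; $\mathcal I_A,\mathcal I_B$ denote the identity channels. For a state $\rho$ and a channel $\Phi$ put $$T_\alpha(\rho,\Phi)=\sum_i\left(\operatorname{tr}\rho K_i^\dagger K_i-\operatorname{tr}\rho^{\alpha}K_i\rho^{1-\alpha}K_i^\dagger\right)=1-\operatorname{tr}\rho^\alpha\Phi(\rho^{1-\alpha}),$$ and for a state $\rho_{AB}$ on $H_A\otimes H_B$ with reduced state $\rho_A=\operatorname{tr}_B\rho_{AB}$ and a channel $\Phi_A$ on $A$ put $$D^T_\alpha(\rho_{AB}|\Phi_A)=T_\alpha(\rho_{AB},\Phi_A\otimes\mathcal I_B)-T_\alpha(\rho_A,\Phi_A).$$ Theorem 2. For every state $\rho_{AB}$ on $H_A\otimes H_B$ and every channel $\Phi_A(X)=\sum_iK_iXK_i^\dagger$ on $A$: (i) (Non-negativity)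 $D^T_\alpha(\rho_{AB}|\Phi_A)\ge 0$, with equality when $\rho_{AB}=\rho_A\otimes\rho_B$ is a product state. (ii) (Unitary covariance) For all unitary operators $U_A$ on $H_A$ and $U_B$ on $H_B$, $$D^T_\alpha\big((U_A\otimes U_B)\rho_{AB}(U_A\otimes U_B)^\dagger\,\big|\,\Phi_A\big)=D^T_\alpha\big(\rho_{AB}\,\big|\,\mathcal U_A^\dagger\Phi_A\,\mathcal U_A\big),$$ where $\mathcal U_A^\dagger\Phi_A\,\mathcal U_A(X)=\sum_i(U_A^\dagger K_iU_A)X(U_A^\dagger K_iU_A)^\dagger$. (iii) (Contractivity) For every channel $\Phi_B$ on $B$, $$D^T_\alpha\big((\mathcal I_A\otimes\Phi_B)(\rho_{AB})\,\big|\,\Phi_A\big)\le D^T_\alpha(\rho_{AB}|\Phi_A).$$ -/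

import Mathlib

open scoped Matrix Kronecker ComplexOrder MatrixOrder

/-- Density operators on the finite-dimensional Hilbert space `ℂⁿ`: positive operators of trace
one. -/
def IsDensity {n : Type*} [Fintype n] (ρ : Matrix n n ℂ) : Prop :=
  ρ.PosSemidef ∧ ρ.trace = 1

/-- A quantum channel on the system `ℂⁿ`, presented by a finite family of Kraus operators `K i`
with `∑ i, (K i)ᴴ * K i = 1`. -/
structure QuantumChannel (n : Type*) [Fintype n] [DecidableEq n] where
  /-- the number of Kraus operators -/
  size : ℕ
  /-- the Kraus operators -/
  kraus : Fin size → Matrix n n ℂ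
  complete : ∑ i, (kraus i)ᴴ * kraus i = 1

namespace QuantumChannel

variable {n A B : Type*} [Fintype n] [DecidableEq n] [Fintype A] [DecidableEq A]
  [Fintype B] [DecidableEq B]

/-- The action `Φ(X) = ∑ i, K i * X * (K i)ᴴ` of a channel. -/
def apply (Φ : QuantumChannel n) (X : Matrix n n ℂ) : Matrix n n ℂ :=
  ∑ i, Φ.kraus i * X * (Φ.kraus i)ᴴ

/-- The channel `Φ ⊗ 𝓘_B` on `AB`, with Kraus operators `K i ⊗ I_B`. -/
def tensorId (Φ : QuantumChannel A) (B : Type*) [Fintype B] [DecidableEq B] :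
    QuantumChannel (A × B) where
  size := Φ.size
  kraus i := Φ.kraus i ⊗ₖ (1 : Matrix B B ℂ)
  complete := by
    have h (i : Fin Φ.size) :
        (Φ.kraus i ⊗ₖ (1 : Matrix B B ℂ))ᴴ * (Φ.kraus i ⊗ₖ (1 : Matrix B B ℂ)) =
          ((Φ.kraus i)ᴴ * Φ.kraus i) ⊗ₖ (1 : Matrix B B ℂ) := by
      rw [Matrix.conjTranspose_kronecker, Matrix.conjTranspose_one, ← Matrix.mul_kronecker_mul,
        mul_one]
    simp_rw [h]
    ext ⟨a, b⟩ ⟨a', b'⟩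
    have e := congrFun (congrFun Φ.complete a) a'
    simp only [Matrix.sum_apply] at e
    simp only [Matrix.sum_apply, Matrix.kroneckerMap_apply, ← Finset.sum_mul]
    rw [e, ← Matrix.one_kronecker_one, Matrix.kroneckerMap_apply]

/-- The channel `𝓘_A ⊗ Ψ` on `AB`, with Kraus operators `I_A ⊗ L j`. -/
def idTensor (A : Type*) [Fintype A] [DecidableEq A] (Ψ : QuantumChannel B) :
    QuantumChannel (A × B) where
  size := Ψ.size
  kraus j := (1 : Matrix A A ℂ) ⊗ₖ Ψ.kraus j
  complete := by
    have h (j : Fin Ψ.size) :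
        ((1 : Matrix A A ℂ) ⊗ₖ Ψ.kraus j)ᴴ * ((1 : Matrix A A ℂ) ⊗ₖ Ψ.kraus j) =
          (1 : Matrix A A ℂ) ⊗ₖ ((Ψ.kraus j)ᴴ * Ψ.kraus j) := by
      rw [Matrix.conjTranspose_kronecker, Matrix.conjTranspose_one, ← Matrix.mul_kronecker_mul,
        mul_one]
    simp_rw [h]
    ext ⟨a, b⟩ ⟨a', b'⟩
    have e := congrFun (congrFun Ψ.complete b) b'
    simp only [Matrix.sum_apply] at e
    simp only [Matrix.sum_apply, Matrix.kroneckerMap_apply, ← Finset.mul_sum]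
    rw [e, ← Matrix.one_kronecker_one, Matrix.kroneckerMap_apply]

/-- The channel `𝓤† Φ 𝓤`, with Kraus operators `Uᴴ * K i * U`. -/
def conj (Φ : QuantumChannel n) (U : Matrix.unitaryGroup n ℂ) : QuantumChannel n where
  size := Φ.size
  kraus i := (U : Matrix n n ℂ)ᴴ * Φ.kraus i * (U : Matrix n n ℂ)
  complete := by
    have hU : (U : Matrix n n ℂ)ᴴ * (U : Matrix n n ℂ) = 1 := Matrix.mem_unitaryGroup_iff'.mp U.2
    have hU' : (U : Matrix n n ℂ) * (U : Matrix n n ℂ)ᴴ = 1 := Matrix.mem_unitaryGroup_iff.mp U.2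
    have h (i : Fin Φ.size) :
        ((U : Matrix n n ℂ)ᴴ * Φ.kraus i * (U : Matrix n n ℂ))ᴴ *
            ((U : Matrix n n ℂ)ᴴ * Φ.kraus i * (U : Matrix n n ℂ)) =
          (U : Matrix n n ℂ)ᴴ * ((Φ.kraus i)ᴴ * Φ.kraus i) * (U : Matrix n n ℂ) := by
      simp only [Matrix.conjTranspose_mul, Matrix.conjTranspose_conjTranspose, Matrix.mul_assoc]
      rw [← Matrix.mul_assoc (U : Matrix n n ℂ) (U : Matrix n n ℂ)ᴴ, hU', Matrix.one_mul]
    simp_rw [h]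
    rw [← Finset.sum_mul, ← Finset.mul_sum, Φ.complete, mul_one, hU]

end QuantumChannel

/-- The reduced state `ρ_A = tr_B ρ_AB`. -/
def partialTraceB {A B : Type*} [Fintype B] (ρ : Matrix (A × B) (A × B) ℂ) : Matrix A A ℂ :=
  Matrix.of fun a a' => ∑ b, ρ (a, b) (a', b)

/-- The modified Wigner–Yanase–Dyson skew information of `ρ` relative to an operator `K`,
`T_α(ρ, K) = tr(ρ K† K) - tr(ρ^α K ρ^(1-α) K†)`. The powers are those of the continuous functional
calculus. For Hermitian `ρ` the traces are real, see `skewInfoOp_coe`. -/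
noncomputable def skewInfoOp {n : Type*} [Fintype n] [DecidableEq n] (α : ℝ)
    (ρ K : Matrix n n ℂ) : ℝ :=
  ((ρ * Kᴴ * K).trace - (ρ ^ α * K * ρ ^ (1 - α) * Kᴴ).trace).re

/-- The modified Wigner–Yanase–Dyson skew information of `ρ` relative to a channel,
`T_α(ρ, Φ) = ∑ i, T_α(ρ, K i)`. It depends on the channel only through its action, see
`skewInfo_eq`. -/
noncomputable def skewInfo {n : Type*} [Fintype n] [DecidableEq n] (α : ℝ)
    (ρ : Matrix n n ℂ) (Φ : QuantumChannel n) : ℝ :=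
  ∑ i, skewInfoOp α ρ (Φ.kraus i)

/-- The correlation quantifier
`D^T_α(ρ_AB | Φ_A) = T_α(ρ_AB, Φ_A ⊗ 𝓘_B) - T_α(ρ_A, Φ_A)`. -/
noncomputable def corrQuantifier {A B : Type*} [Fintype A] [DecidableEq A] [Fintype B]
    [DecidableEq B] (α : ℝ) (ρ : Matrix (A × B) (A × B) ℂ) (Φ : QuantumChannel A) : ℝ :=
  skewInfo α ρ (Φ.tensorId B) - skewInfo α (partialTraceB ρ) Φ

theorem skewInfoOp_coe {n : Type*} [Fintype n] [DecidableEq n] (α : ℝ)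
    (ρ K : Matrix n n ℂ) (hρ : ρ.IsHermitian) :
    (skewInfoOp α ρ K : ℂ) =
      (ρ * Kᴴ * K).trace - (ρ ^ α * K * ρ ^ (1 - α) * Kᴴ).trace := by
  have hp (s : ℝ) : (ρ ^ s)ᴴ = ρ ^ s :=
    (Matrix.nonneg_iff_posSemidef.mp (CFC.rpow_nonneg (a := ρ) (y := s))).isHermitian
  rw [skewInfoOp, ← Complex.conj_eq_iff_re, map_sub]
  congr 1
  · rw [starRingEnd_apply, ← Matrix.trace_conjTranspose]
    simp only [Matrix.conjTranspose_mul, Matrix.conjTranspose_conjTranspose, hρ.eq]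
    rw [← Matrix.mul_assoc, Matrix.trace_mul_comm, Matrix.mul_assoc]
  · rw [starRingEnd_apply, ← Matrix.trace_conjTranspose]
    simp only [Matrix.conjTranspose_mul, Matrix.conjTranspose_conjTranspose, hp]
    rw [← Matrix.mul_assoc, ← Matrix.mul_assoc, Matrix.trace_mul_comm]
    simp only [Matrix.mul_assoc]

theorem skewInfo_eq {n : Type*} [Fintype n] [DecidableEq n] (α : ℝ)
    (ρ : Matrix n n ℂ) (hρ : IsDensity ρ) (Φ : QuantumChannel n) :
    (skewInfo α ρ Φ : ℂ) = 1 - (ρ ^ α * Φ.apply (ρ ^ (1 - α))).trace := by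
  rw [skewInfo, Complex.ofReal_sum]
  simp_rw [skewInfoOp_coe α ρ _ hρ.1.isHermitian]
  rw [Finset.sum_sub_distrib, ← Matrix.trace_sum, ← Matrix.trace_sum, QuantumChannel.apply,
    Finset.mul_sum]
  simp only [Matrix.mul_assoc]
  rw [← Finset.mul_sum, Φ.complete, mul_one, hρ.2]

/-!
By the defining property of the reduced state, the terms `tr(ρ K† K)` of the two skew informations
cancel, and `corrQuantifier α ρ Φ` is the sum over the Kraus operators `K` of
`F(ρ_A, K) - F(ρ, K ⊗ I)`, where `F(ρ, K) = tr(ρ^α K ρ^(1-α) K†)` is `wydForm`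
(`corrQuantifier_eq`).

Non-negativity and contractivity both follow from the monotonicity `wydForm_dual_le`:
`F(ρ, E†(K)) ≤ F(E(ρ), K)` for every channel `E` with dual `E†`. For the partial trace
`E†(K) = K ⊗ I`, and for `E = 𝓘 ⊗ Ψ` the dual fixes `K ⊗ I`, while the reduced state on `A` does not
change.

For the monotonicity, let `λ i` be the eigenvalues of `ρ` and `K i j` the entries of `K` in an
eigenbasis. Then `F(ρ, K) = ∑ i j, λ i ^ α * λ j ^ (1 - α) * |K i j|²`, and the integral
representation of `x ↦ x ^ α` writes this as a positive multiple of the integral over `t > 0` of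
`t^(α-2) * ∑ i j, (t λ i λ j / (λ i + t λ j)) * |K i j|²` (`wydForm_eq_integral`). The coefficient
is a parallel sum, so the sum is the minimum of `tr(ρ X X†) + t tr(Y ρ Y†)` over the decompositions
`K = X + Y` (`sum_meanKernel_le_splitForm`, `exists_splitForm_eq_sum_meanKernel`). If `K = X + Y` is
optimal for `E(ρ)`, then `E†(K) = E†(X) + E†(Y)` is a competitor for `ρ`, and by the Schwarz
inequality for `E†` it gives a value that is no larger (`splitForm_dual_le`).

The product case and unitary covariance are computations, given that powers of a matrix can be read
off from any diagonalization (`Matrix.rpow_of_diagonalization`).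
-/

open MeasureTheory Set

/-! ### Powers of a diagonalized matrix -/

theorem Matrix.PosSemidef.exists_diagonalization {n : Type*} [Fintype n] [DecidableEq n]
    {ρ : Matrix n n ℂ} (hρ : ρ.PosSemidef) :
    ∃ (W : Matrix n n ℂ) (d : n → ℝ), Wᴴ * W = 1 ∧ (∀ i, 0 ≤ d i) ∧
      ρ = W * Matrix.diagonal (fun i => (d i : ℂ)) * Wᴴ := by
  refine ⟨hρ.isHermitian.eigenvectorUnitary, hρ.isHermitian.eigenvalues,
    Matrix.mem_unitaryGroup_iff'.mp hρ.isHermitian.eigenvectorUnitary.2, hρ.eigenvalues_nonneg, ?_⟩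
  conv_lhs => rw [hρ.isHermitian.spectral_theorem, Unitary.conjStarAlgAut_apply]
  rfl

theorem Matrix.posSemidef_of_diagonalization {n : Type*} [Fintype n] [DecidableEq n]
    {W : Matrix n n ℂ} {d : n → ℝ} (hd : ∀ i, 0 ≤ d i) :
    (W * Matrix.diagonal (fun i => (d i : ℂ)) * Wᴴ).PosSemidef :=
  (Matrix.PosSemidef.diagonal fun i => by simpa using hd i).mul_mul_conjTranspose_same W

/-- The diagonalization is arbitrary, so that powers can be compared across products, unitary
conjugates and any choice of eigenbasis. -/
theorem Matrix.rpow_of_diagonalization {n : Type*} [Fintype n] [DecidableEq n]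
    {ρ W : Matrix n n ℂ} {d : n → ℝ} (hW : Wᴴ * W = 1) (hd : ∀ i, 0 ≤ d i)
    (hρ : ρ = W * Matrix.diagonal (fun i => (d i : ℂ)) * Wᴴ) (s : ℝ) :
    ρ ^ s = W * Matrix.diagonal (fun i => ((d i ^ s : ℝ) : ℂ)) * Wᴴ := by
  have hpos : ρ.PosSemidef := hρ ▸ Matrix.posSemidef_of_diagonalization hd
  have hH := hpos.isHermitian
  set V : Matrix n n ℂ := ↑hH.eigenvectorUnitary
  have hVV : Vᴴ * V = 1 := Matrix.mem_unitaryGroup_iff'.mp hH.eigenvectorUnitary.2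
  have hVV' : V * Vᴴ = 1 := Matrix.mem_unitaryGroup_iff.mp hH.eigenvectorUnitary.2
  have hW' : W * Wᴴ = 1 := mul_eq_one_comm.mp hW
  set e := hH.eigenvalues
  have h1 : ρ = V * Matrix.diagonal (fun i => (e i : ℂ)) * Vᴴ := by
    conv_lhs => rw [hH.spectral_theorem, Unitary.conjStarAlgAut_apply]
    rfl
  have h2 : ρ ^ s = V * Matrix.diagonal (fun i => ((e i ^ s : ℝ) : ℂ)) * Vᴴ := by
    have h0 : (0 : Matrix n n ℂ) ≤ ρ := Matrix.nonneg_iff_posSemidef.mpr hpos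
    rw [CFC.rpow_def, cfc_nnreal_eq_real _ ρ, hH.cfc_eq, Matrix.IsHermitian.cfc,
      Unitary.conjStarAlgAut_apply]
    congr 3
    funext i
    have := hpos.eigenvalues_nonneg i
    simp [e, this]
  -- `Vᴴ * W` intertwines the two diagonal matrices, hence every function of them.
  have h3 : Matrix.diagonal (fun i => (e i : ℂ)) * (Vᴴ * W) =
      (Vᴴ * W) * Matrix.diagonal (fun i => (d i : ℂ)) := by
    calc _ = Vᴴ * V * Matrix.diagonal (fun i => (e i : ℂ)) * Vᴴ * W := by
            rw [hVV]; simp only [Matrix.mul_assoc, Matrix.one_mul]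
      _ = Vᴴ * ρ * W := by rw [h1]; simp only [Matrix.mul_assoc]
      _ = Vᴴ * W * Matrix.diagonal (fun i => (d i : ℂ)) * (Wᴴ * W) := by
            rw [hρ]; simp only [Matrix.mul_assoc]
      _ = _ := by rw [hW, Matrix.mul_one]
  have h4 : Matrix.diagonal (fun i => ((e i ^ s : ℝ) : ℂ)) * (Vᴴ * W) =
      (Vᴴ * W) * Matrix.diagonal (fun i => ((d i ^ s : ℝ) : ℂ)) := by
    ext i j
    have h := congrFun (congrFun h3 i) j
    rw [Matrix.diagonal_mul, Matrix.mul_diagonal] at h ⊢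
    by_cases hz : (Vᴴ * W) i j = 0
    · simp [hz]
    · have : (e i : ℂ) = d j := mul_right_cancel₀ hz (h.trans (mul_comm _ _))
      rw [Complex.ofReal_injective this, mul_comm]
  calc ρ ^ s = V * (Matrix.diagonal (fun i => ((e i ^ s : ℝ) : ℂ)) * (Vᴴ * W)) * Wᴴ := by
        rw [h2]; simp only [Matrix.mul_assoc, hW', Matrix.mul_one]
    _ = V * Vᴴ * W * Matrix.diagonal (fun i => ((d i ^ s : ℝ) : ℂ)) * Wᴴ := by
        rw [h4]; simp only [Matrix.mul_assoc]
    _ = _ := by rw [hVV', Matrix.one_mul]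

theorem Matrix.PosSemidef.rpow_unitary_conj {n : Type*} [Fintype n] [DecidableEq n]
    {ρ W : Matrix n n ℂ} (hρ : ρ.PosSemidef) (hW : Wᴴ * W = 1) (s : ℝ) :
    (W * ρ * Wᴴ) ^ s = W * ρ ^ s * Wᴴ := by
  obtain ⟨V, d, hV, hd, h⟩ := hρ.exists_diagonalization
  have hVW : (W * V)ᴴ * (W * V) = 1 := by
    rw [Matrix.conjTranspose_mul, Matrix.mul_assoc, ← Matrix.mul_assoc Wᴴ, hW, Matrix.one_mul, hV]
  rw [Matrix.rpow_of_diagonalization hV hd h, Matrix.rpow_of_diagonalization hVW hd]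
  · simp only [Matrix.conjTranspose_mul, Matrix.mul_assoc]
  · simp only [h, Matrix.conjTranspose_mul, Matrix.mul_assoc]

theorem Matrix.PosSemidef.rpow_kronecker {m n : Type*} [Fintype m] [DecidableEq m] [Fintype n]
    [DecidableEq n] {ρ : Matrix m m ℂ} {σ : Matrix n n ℂ} (hρ : ρ.PosSemidef)
    (hσ : σ.PosSemidef) (s : ℝ) : (ρ ⊗ₖ σ) ^ s = (ρ ^ s) ⊗ₖ (σ ^ s) := by
  obtain ⟨V, d, hV, hd, h⟩ := hρ.exists_diagonalization
  obtain ⟨W, e, hW, he, h'⟩ := hσ.exists_diagonalization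
  have hVW : (V ⊗ₖ W)ᴴ * (V ⊗ₖ W) = 1 := by
    rw [Matrix.conjTranspose_kronecker, ← Matrix.mul_kronecker_mul, hV, hW,
      Matrix.one_kronecker_one]
  rw [Matrix.rpow_of_diagonalization hV hd h, Matrix.rpow_of_diagonalization hW he h',
    Matrix.rpow_of_diagonalization (d := fun p => d p.1 * e p.2) hVW
      (fun p => mul_nonneg (hd _) (he _))]
  · simp only [Matrix.mul_kronecker_mul, Matrix.conjTranspose_kronecker,
      Matrix.diagonal_kronecker_diagonal, Real.mul_rpow (hd _) (he _), Complex.ofReal_mul]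
  · simp only [h, h', Matrix.mul_kronecker_mul, Matrix.conjTranspose_kronecker,
      Matrix.diagonal_kronecker_diagonal, Complex.ofReal_mul]

/-! ### The form `tr(ρ^α K ρ^(1-α) K†)` in an eigenbasis -/

theorem Matrix.re_trace_diagonal_mul {n : Type*} [Fintype n] [DecidableEq n]
    (W X : Matrix n n ℂ) (a b : n → ℝ) :
    (W * Matrix.diagonal (fun i => (a i : ℂ)) * Wᴴ * X *
        (W * Matrix.diagonal (fun i => (b i : ℂ)) * Wᴴ) * Xᴴ).trace.re =
      ∑ i, ∑ j, a i * b j * Complex.normSq ((Wᴴ * X * W) i j) := by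
  have h : (W * Matrix.diagonal (fun i => (a i : ℂ)) * Wᴴ * X *
        (W * Matrix.diagonal (fun i => (b i : ℂ)) * Wᴴ) * Xᴴ).trace =
      (Matrix.diagonal (fun i => (a i : ℂ)) * ((Wᴴ * X * W) *
        (Matrix.diagonal (fun i => (b i : ℂ)) * (Wᴴ * X * W)ᴴ))).trace := by
    simp only [Matrix.mul_assoc]
    rw [Matrix.trace_mul_comm]
    simp only [Matrix.conjTranspose_mul, Matrix.conjTranspose_conjTranspose, Matrix.mul_assoc]
  rw [h, Matrix.trace, Complex.re_sum]
  refine Finset.sum_congr rfl fun i _ => ?_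
  rw [Matrix.diag_apply, Matrix.diagonal_mul, Matrix.mul_apply, Finset.mul_sum, Complex.re_sum]
  refine Finset.sum_congr rfl fun j _ => ?_
  rw [Matrix.diagonal_mul, Matrix.conjTranspose_apply, Complex.normSq_apply]
  simp
  ring

/-- The form `tr(ρ^α K ρ^(1-α) K†)` subtracted in the skew information. -/
noncomputable def wydForm {n : Type*} [Fintype n] [DecidableEq n] (α : ℝ) (ρ K : Matrix n n ℂ) :
    ℝ :=
  (ρ ^ α * K * ρ ^ (1 - α) * Kᴴ).trace.re

/-- The kernel `t^(α-1) λμ / (λ + tμ)` whose integral over `t > 0` is proportional to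
`λ^α μ^(1-α)`; it is written through Mathlib's `Real.rpowIntegrand₀₁`, and vanishes at `μ = 0`. -/
noncomputable def meanKernel (α t x y : ℝ) : ℝ := y * Real.rpowIntegrand₀₁ α t (x / y)

theorem meanKernel_eq {α t x y : ℝ} (hα : α ∈ Ioo (0 : ℝ) 1) (ht : 0 < t) (hx : 0 ≤ x)
    (hy : 0 ≤ y) : meanKernel α t x y = t ^ (α - 2) * (t * x * y / (x + t * y)) := by
  have h : t ^ (α - 1) = t ^ (α - 2) * t := by
    rw [← Real.rpow_add_one ht.ne']; congr 1; ring
  rw [meanKernel, Real.rpowIntegrand₀₁_eq_pow_div hα ht.le (div_nonneg hx hy), h]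
  rcases hy.eq_or_lt with rfl | hy
  · simp
  · have : 0 < x + t * y := by positivity
    have : 0 < t + x / y := by positivity
    field_simp
    ring

theorem integrableOn_meanKernel {α x y : ℝ} (hα : α ∈ Ioo (0 : ℝ) 1) (hx : 0 ≤ x) (hy : 0 ≤ y) :
    IntegrableOn (fun t => meanKernel α t x y) (Ioi 0) :=
  (Real.integrableOn_rpowIntegrand₀₁_Ioi hα (div_nonneg hx hy)).const_mul y

theorem rpow_mul_rpow_eq_integral_meanKernel {α x y : ℝ} (hα : α ∈ Ioo (0 : ℝ) 1) (hx : 0 ≤ x)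
    (hy : 0 ≤ y) :
    x ^ α * y ^ (1 - α) =
      (∫ t in Ioi 0, Real.rpowIntegrand₀₁ α t 1)⁻¹ * ∫ t in Ioi 0, meanKernel α t x y := by
  have h : x ^ α * y ^ (1 - α) = y * (x / y) ^ α := by
    rcases hy.eq_or_lt with rfl | hy
    · simp [Real.zero_rpow (sub_pos.mpr hα.2).ne']
    · rw [Real.div_rpow hx hy.le, Real.rpow_sub hy, Real.rpow_one]
      ring
  rw [h, Real.rpow_eq_const_mul_integral hα (div_nonneg hx hy)]
  simp only [meanKernel]
  rw [integral_const_mul]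
  ring

theorem wydForm_eq_integral {n : Type*} [Fintype n] [DecidableEq n] {α : ℝ}
    (hα : α ∈ Ioo (0 : ℝ) 1) {ρ W : Matrix n n ℂ} {d : n → ℝ} (hW : Wᴴ * W = 1)
    (hd : ∀ i, 0 ≤ d i) (hρ : ρ = W * Matrix.diagonal (fun i => (d i : ℂ)) * Wᴴ)
    (K : Matrix n n ℂ) :
    wydForm α ρ K = (∫ t in Ioi 0, Real.rpowIntegrand₀₁ α t 1)⁻¹ *
      ∫ t in Ioi 0, ∑ i, ∑ j, meanKernel α t (d i) (d j) *
        Complex.normSq ((Wᴴ * K * W) i j) := by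
  have hint (i j : n) : IntegrableOn (fun t => meanKernel α t (d i) (d j) *
      Complex.normSq ((Wᴴ * K * W) i j)) (Ioi 0) :=
    (integrableOn_meanKernel hα (hd i) (hd j)).mul_const _
  rw [wydForm, Matrix.rpow_of_diagonalization hW hd hρ, Matrix.rpow_of_diagonalization hW hd hρ,
    Matrix.re_trace_diagonal_mul,
    integral_finsetSum _ fun i _ => integrable_finsetSum _ fun j _ => hint i j, Finset.mul_sum]
  refine Finset.sum_congr rfl fun i _ => ?_
  rw [integral_finsetSum _ fun j _ => hint i j, Finset.mul_sum]
  refine Finset.sum_congr rfl fun j _ => ?_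
  rw [integral_mul_const, rpow_mul_rpow_eq_integral_meanKernel hα (hd i) (hd j)]
  ring

/-! ### The integrand as a minimum -/

theorem parallelSum_mul_normSq_le {a b : ℝ} (ha : 0 ≤ a) (hb : 0 ≤ b) (x y : ℂ) :
    a * b / (a + b) * Complex.normSq (x + y) ≤ a * Complex.normSq x + b * Complex.normSq y := by
  rcases (add_nonneg ha hb).eq_or_lt with h | h
  · rw [← h, div_zero, zero_mul]
    have := Complex.normSq_nonneg x
    have := Complex.normSq_nonneg y
    positivity
  · rw [div_mul_eq_mul_div, div_le_iff₀ h]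
    simp only [Complex.normSq_apply, Complex.add_re, Complex.add_im]
    nlinarith [sq_nonneg (a * x.re - b * y.re), sq_nonneg (a * x.im - b * y.im)]

theorem exists_parallelSum_mul_normSq_eq {a b : ℝ} (ha : 0 ≤ a) (hb : 0 ≤ b) (z : ℂ) :
    ∃ x y : ℂ, x + y = z ∧
      a * Complex.normSq x + b * Complex.normSq y = a * b / (a + b) * Complex.normSq z := by
  rcases (add_nonneg ha hb).eq_or_lt with h | h
  · obtain rfl : a = 0 := by linarith
    obtain rfl : b = 0 := by linarith
    exact ⟨z, 0, by simp, by simp⟩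
  · refine ⟨((b / (a + b) : ℝ) : ℂ) * z, ((a / (a + b) : ℝ) : ℂ) * z, ?_, ?_⟩
    · rw [← add_mul, ← Complex.ofReal_add, ← add_div, add_comm b a, div_self h.ne',
        Complex.ofReal_one, one_mul]
    · simp only [Complex.normSq_mul, Complex.normSq_ofReal]
      field_simp
      ring

/-- The quadratic form `tr(ρ X X†) + t tr(Y ρ Y†)`, whose minimum over the decompositions
`K = X + Y` is the integrand of `wydForm_eq_integral` up to the factor `t^(α-2)`. -/
noncomputable def splitForm {n : Type*} [Fintype n] (t : ℝ) (ρ X Y : Matrix n n ℂ) : ℝ :=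
  (ρ * X * Xᴴ).trace.re + t * (Y * ρ * Yᴴ).trace.re

theorem splitForm_eq_sum {n : Type*} [Fintype n] [DecidableEq n] (t : ℝ) {ρ W : Matrix n n ℂ}
    {d : n → ℝ} (hW : Wᴴ * W = 1) (hρ : ρ = W * Matrix.diagonal (fun i => (d i : ℂ)) * Wᴴ)
    (X Y : Matrix n n ℂ) :
    splitForm t ρ X Y = ∑ i, ∑ j, (d i * Complex.normSq ((Wᴴ * X * W) i j) +
      t * d j * Complex.normSq ((Wᴴ * Y * W) i j)) := by
  have hW' : W * Wᴴ = 1 := mul_eq_one_comm.mp hW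
  have h1 := Matrix.re_trace_diagonal_mul W X d (fun _ => 1)
  have h2 := Matrix.re_trace_diagonal_mul W Y (fun _ => 1) d
  simp only [Complex.ofReal_one, Matrix.diagonal_one, hW', mul_one, one_mul,
    ← hρ] at h1 h2
  rw [splitForm, h1, h2]
  simp only [Finset.sum_add_distrib, Finset.mul_sum, mul_assoc]

theorem sum_meanKernel_le_splitForm {n : Type*} [Fintype n] [DecidableEq n] {α t : ℝ}
    (hα : α ∈ Ioo (0 : ℝ) 1) (ht : 0 < t) {ρ W : Matrix n n ℂ} {d : n → ℝ} (hW : Wᴴ * W = 1)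
    (hd : ∀ i, 0 ≤ d i) (hρ : ρ = W * Matrix.diagonal (fun i => (d i : ℂ)) * Wᴴ)
    (X Y : Matrix n n ℂ) :
    ∑ i, ∑ j, meanKernel α t (d i) (d j) * Complex.normSq ((Wᴴ * (X + Y) * W) i j) ≤
      t ^ (α - 2) * splitForm t ρ X Y := by
  rw [splitForm_eq_sum t hW hρ, Finset.mul_sum]
  refine Finset.sum_le_sum fun i _ => ?_
  rw [Finset.mul_sum]
  refine Finset.sum_le_sum fun j _ => ?_
  rw [meanKernel_eq hα ht (hd i) (hd j), mul_assoc]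
  refine mul_le_mul_of_nonneg_left ?_ (Real.rpow_nonneg ht.le _)
  rw [Matrix.mul_add, Matrix.add_mul, Matrix.add_apply, mul_comm t (d i), mul_assoc (d i)]
  exact parallelSum_mul_normSq_le (hd i) (mul_nonneg ht.le (hd j)) _ _

theorem exists_splitForm_eq_sum_meanKernel {n : Type*} [Fintype n] [DecidableEq n] {α t : ℝ}
    (hα : α ∈ Ioo (0 : ℝ) 1) (ht : 0 < t) {ρ W : Matrix n n ℂ} {d : n → ℝ} (hW : Wᴴ * W = 1)
    (hd : ∀ i, 0 ≤ d i) (hρ : ρ = W * Matrix.diagonal (fun i => (d i : ℂ)) * Wᴴ)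
    (K : Matrix n n ℂ) :
    ∃ X Y, X + Y = K ∧ t ^ (α - 2) * splitForm t ρ X Y =
      ∑ i, ∑ j, meanKernel α t (d i) (d j) * Complex.normSq ((Wᴴ * K * W) i j) := by
  have hW' : W * Wᴴ = 1 := mul_eq_one_comm.mp hW
  choose x y hxy hmin using fun i j => exists_parallelSum_mul_normSq_eq (hd i)
    (mul_nonneg ht.le (hd j)) ((Wᴴ * K * W) i j)
  have hcancel (M : Matrix n n ℂ) : Wᴴ * (W * M * Wᴴ) * W = M := by
    rw [← Matrix.mul_assoc, ← Matrix.mul_assoc, hW, Matrix.one_mul, Matrix.mul_assoc, hW,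
      Matrix.mul_one]
  refine ⟨W * Matrix.of x * Wᴴ, W * Matrix.of y * Wᴴ, ?_, ?_⟩
  · have : Matrix.of x + Matrix.of y = Wᴴ * K * W := by
      ext i j
      exact hxy i j
    rw [← Matrix.add_mul, ← Matrix.mul_add, this, ← Matrix.mul_assoc, ← Matrix.mul_assoc, hW',
      Matrix.one_mul, Matrix.mul_assoc, hW', Matrix.mul_one]
  · rw [splitForm_eq_sum t hW hρ, hcancel, hcancel, Finset.mul_sum]
    refine Finset.sum_congr rfl fun i _ => ?_
    rw [Finset.mul_sum]
    refine Finset.sum_congr rfl fun j _ => ?_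
    rw [meanKernel_eq hα ht (hd i) (hd j), Matrix.of_apply, Matrix.of_apply, hmin]
    ring

/-! ### Monotonicity under channels -/

/-- The Schwarz inequality `Φ†(X) Φ†(X)† ≤ Φ†(X X†)` for the dual `Φ†(X) = ∑ j, V j† X V j` of a
channel, tested against a state. -/
theorem trace_dual_mul_dual_le {ι m n : Type*} [Fintype ι] [Fintype m] [DecidableEq m] [Fintype n]
    [DecidableEq n] (V : ι → Matrix m n ℂ) (hV : ∑ j, (V j)ᴴ * V j = 1) {ρ : Matrix n n ℂ}
    (hρ : ρ.PosSemidef) (X : Matrix m m ℂ) :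
    (ρ * (∑ j, (V j)ᴴ * X * V j) * (∑ j, (V j)ᴴ * X * V j)ᴴ).trace.re ≤
      ((∑ j, V j * ρ * (V j)ᴴ) * X * Xᴴ).trace.re := by
  set M := ∑ j, (V j)ᴴ * X * V j with hM
  have hMt : Mᴴ = ∑ j, (V j)ᴴ * Xᴴ * V j := by
    simp only [hM, Matrix.conjTranspose_sum, Matrix.conjTranspose_mul,
      Matrix.conjTranspose_conjTranspose, Matrix.mul_assoc]
  -- The defect in the Schwarz inequality is the sum of the squares of `V j† X - M V j†`.
  have hexp : ∑ j, ((V j)ᴴ * X - M * (V j)ᴴ) * ((V j)ᴴ * X - M * (V j)ᴴ)ᴴ =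
      ∑ j, (V j)ᴴ * (X * Xᴴ) * V j - M * Mᴴ := by
    have h (j : ι) : ((V j)ᴴ * X - M * (V j)ᴴ) * ((V j)ᴴ * X - M * (V j)ᴴ)ᴴ =
        (V j)ᴴ * (X * Xᴴ) * V j - ((V j)ᴴ * X * V j) * Mᴴ - M * ((V j)ᴴ * Xᴴ * V j) +
          M * ((V j)ᴴ * V j) * Mᴴ := by
      simp only [Matrix.conjTranspose_sub, Matrix.conjTranspose_mul,
        Matrix.conjTranspose_conjTranspose, Matrix.mul_sub, Matrix.sub_mul, Matrix.mul_assoc]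
      abel
    simp only [h]
    rw [Finset.sum_add_distrib, Finset.sum_sub_distrib, Finset.sum_sub_distrib, ← Finset.sum_mul,
      ← Finset.mul_sum, ← Finset.sum_mul, ← Finset.mul_sum, hV, ← hM, ← hMt, Matrix.mul_one]
    abel
  have hnn (j : ι) : 0 ≤ (ρ * (((V j)ᴴ * X - M * (V j)ᴴ) *
      ((V j)ᴴ * X - M * (V j)ᴴ)ᴴ)).trace.re := by
    rw [← Matrix.mul_assoc, Matrix.trace_mul_comm, ← Matrix.mul_assoc]
    exact (Complex.nonneg_iff.mp (hρ.conjTranspose_mul_mul_same _).trace_nonneg).1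
  have hsum := Finset.sum_nonneg fun j (_ : j ∈ Finset.univ) => hnn j
  rw [← Complex.re_sum, ← Matrix.trace_sum, ← Finset.mul_sum, hexp, Matrix.mul_sub,
    Matrix.trace_sub, Complex.sub_re, sub_nonneg, ← Matrix.mul_assoc] at hsum
  refine hsum.trans_eq ?_
  congr 1
  rw [Finset.mul_sum, Matrix.mul_assoc, Finset.sum_mul, Matrix.trace_sum, Matrix.trace_sum]
  refine Finset.sum_congr rfl fun j _ => ?_
  rw [← Matrix.mul_assoc, Matrix.trace_mul_comm]
  simp only [Matrix.mul_assoc]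

theorem splitForm_dual_le {ι m n : Type*} [Fintype ι] [Fintype m] [DecidableEq m] [Fintype n]
    [DecidableEq n] (V : ι → Matrix m n ℂ) (hV : ∑ j, (V j)ᴴ * V j = 1) {ρ : Matrix n n ℂ}
    (hρ : ρ.PosSemidef) {t : ℝ} (ht : 0 ≤ t) (X Y : Matrix m m ℂ) :
    splitForm t ρ (∑ j, (V j)ᴴ * X * V j) (∑ j, (V j)ᴴ * Y * V j) ≤
      splitForm t (∑ j, V j * ρ * (V j)ᴴ) X Y := by
  -- `tr(Y ρ Y†) = tr(ρ Y† Y)` is the Schwarz inequality for `Y†`.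
  have hY := trace_dual_mul_dual_le V hV hρ Yᴴ
  have hd : ∑ j, (V j)ᴴ * Yᴴ * V j = (∑ j, (V j)ᴴ * Y * V j)ᴴ := by
    simp only [Matrix.conjTranspose_sum, Matrix.conjTranspose_mul,
      Matrix.conjTranspose_conjTranspose, Matrix.mul_assoc]
  rw [hd, Matrix.conjTranspose_conjTranspose, Matrix.conjTranspose_conjTranspose,
    Matrix.trace_mul_comm, ← Matrix.mul_assoc, Matrix.trace_mul_comm _ Y, ← Matrix.mul_assoc] at hY
  exact add_le_add (trace_dual_mul_dual_le V hV hρ X) (mul_le_mul_of_nonneg_left hY ht)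

/-- Monotonicity of `tr(ρ^α K ρ^(1-α) K†)` under a channel `ρ ↦ ∑ j, V j ρ V j†` between possibly
different systems, whose dual acts on `K`. Applied to the partial trace of
block-diagonal states, it contains the concavity in `ρ` of this form, which is due to Lieb. -/
theorem wydForm_dual_le {ι m n : Type*} [Fintype ι] [Fintype m] [DecidableEq m] [Fintype n]
    [DecidableEq n] (V : ι → Matrix m n ℂ) (hV : ∑ j, (V j)ᴴ * V j = 1) {ρ : Matrix n n ℂ}
    (hρ : ρ.PosSemidef) {α : ℝ} (hα : α ∈ Ioo (0 : ℝ) 1) (K : Matrix m m ℂ) :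
    wydForm α ρ (∑ j, (V j)ᴴ * K * V j) ≤ wydForm α (∑ j, V j * ρ * (V j)ᴴ) K := by
  have hσ : (∑ j, V j * ρ * (V j)ᴴ).PosSemidef :=
    Matrix.posSemidef_sum _ fun j _ => hρ.mul_mul_conjTranspose_same (V j)
  obtain ⟨W, d, hW, hd, h⟩ := hρ.exists_diagonalization
  obtain ⟨W', d', hW', hd', h'⟩ := hσ.exists_diagonalization
  rw [wydForm_eq_integral hα hW hd h, wydForm_eq_integral hα hW' hd' h']
  refine mul_le_mul_of_nonneg_left (setIntegral_mono_on ?_ ?_ measurableSet_Ioi fun t ht => ?_) ?_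
  · exact integrable_finsetSum _ fun i _ => integrable_finsetSum _ fun j _ =>
      (integrableOn_meanKernel hα (hd i) (hd j)).mul_const _
  · exact integrable_finsetSum _ fun i _ => integrable_finsetSum _ fun j _ =>
      (integrableOn_meanKernel hα (hd' i) (hd' j)).mul_const _
  · -- The dual maps the optimal decomposition of `K` to a decomposition of its image.
    obtain ⟨X, Y, rfl, hXY⟩ := exists_splitForm_eq_sum_meanKernel hα ht hW' hd' h' K
    rw [← hXY]
    simp only [Matrix.mul_add, Matrix.add_mul, Finset.sum_add_distrib]
    simpa only [Matrix.mul_add, Matrix.add_mul] using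
      (sum_meanKernel_le_splitForm hα ht hW hd h _ _).trans
      (mul_le_mul_of_nonneg_left (splitForm_dual_le V hV hρ (le_of_lt ht) X Y)
        (Real.rpow_nonneg (le_of_lt ht) _))
  · exact inv_nonneg.mpr (setIntegral_nonneg measurableSet_Ioi fun t ht =>
      Real.rpowIntegrand₀₁_nonneg hα.1 (le_of_lt ht) zero_le_one)

theorem wydForm_unitary_conj {n : Type*} [Fintype n] [DecidableEq n] (α : ℝ)
    {ρ W : Matrix n n ℂ} (hρ : ρ.PosSemidef) (hW : Wᴴ * W = 1) (K : Matrix n n ℂ) :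
    wydForm α (W * ρ * Wᴴ) K = wydForm α ρ (Wᴴ * K * W) := by
  rw [wydForm, wydForm, hρ.rpow_unitary_conj hW, hρ.rpow_unitary_conj hW]
  simp only [Matrix.conjTranspose_mul, Matrix.conjTranspose_conjTranspose, Matrix.mul_assoc]
  rw [Matrix.trace_mul_comm]
  simp only [Matrix.mul_assoc]

theorem wydForm_kronecker_one {A B : Type*} [Fintype A] [DecidableEq A] [Fintype B]
    [DecidableEq B] (α : ℝ) {ρ : Matrix A A ℂ} {σ : Matrix B B ℂ} (hρ : ρ.PosSemidef)
    (hσ : IsDensity σ) (K : Matrix A A ℂ) :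
    wydForm α (ρ ⊗ₖ σ) (K ⊗ₖ (1 : Matrix B B ℂ)) = wydForm α ρ K := by
  have h : σ ^ α * σ ^ (1 - α) = σ := by
    obtain ⟨W, d, hW, hd, h⟩ := hσ.1.exists_diagonalization
    have hpow (x : ℝ) (hx : 0 ≤ x) : x ^ α * x ^ (1 - α) = x := by
      rw [← Real.rpow_add' hx (by norm_num), add_sub_cancel, Real.rpow_one]
    rw [Matrix.rpow_of_diagonalization hW hd h, Matrix.rpow_of_diagonalization hW hd h]
    conv_rhs => rw [h]
    simp only [Matrix.mul_assoc]
    rw [← Matrix.mul_assoc Wᴴ W, hW, Matrix.one_mul, ← Matrix.mul_assoc (Matrix.diagonal _),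
      Matrix.diagonal_mul_diagonal]
    simp only [← Complex.ofReal_mul, hpow _ (hd _)]
  rw [wydForm, wydForm, hρ.rpow_kronecker hσ.1, hρ.rpow_kronecker hσ.1,
    Matrix.conjTranspose_kronecker, Matrix.conjTranspose_one, ← Matrix.mul_kronecker_mul,
    ← Matrix.mul_kronecker_mul, ← Matrix.mul_kronecker_mul, Matrix.mul_one, Matrix.mul_one, h,
    Matrix.trace_kronecker, hσ.2, mul_one]

/-! ### Partial traces -/

theorem trace_partialTraceB_mul {A B : Type*} [Fintype A] [Fintype B] [DecidableEq B]
    (ρ : Matrix (A × B) (A × B) ℂ) (M : Matrix A A ℂ) :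
    (partialTraceB ρ * M).trace = (ρ * (M ⊗ₖ (1 : Matrix B B ℂ))).trace := by
  simp only [Matrix.trace, Matrix.diag_apply, Matrix.mul_apply, partialTraceB, Matrix.of_apply,
    Fintype.sum_prod_type, Matrix.kroneckerMap_apply, Matrix.one_apply, mul_ite, mul_one, mul_zero,
    Finset.sum_ite_eq', Finset.sum_mul, Finset.mem_univ, if_true]
  exact Finset.sum_congr rfl fun a _ => Finset.sum_comm

/-- The Kraus operators `I_A ⊗ ⟨b|` of the partial trace over `B`. -/
def partialTraceKraus (A : Type*) {B : Type*} [DecidableEq A] [DecidableEq B] (b : B) :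
    Matrix A (A × B) ℂ :=
  Matrix.of fun a p => if a = p.1 ∧ b = p.2 then 1 else 0

theorem partialTraceKraus_dual {A B : Type*} [Fintype A] [DecidableEq A] [Fintype B]
    [DecidableEq B] (K : Matrix A A ℂ) :
    ∑ b, (partialTraceKraus A b)ᴴ * K * partialTraceKraus A b = K ⊗ₖ (1 : Matrix B B ℂ) := by
  ext ⟨a, b⟩ ⟨a', b'⟩
  by_cases h : b = b'
  · simp [Matrix.sum_apply, Matrix.mul_apply, partialTraceKraus, ite_and, apply_ite, h]
  · simp [Matrix.sum_apply, Matrix.mul_apply, partialTraceKraus, ite_and, apply_ite, h, Ne.symm h]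

theorem sum_partialTraceKraus {A B : Type*} [Fintype A] [DecidableEq A] [Fintype B]
    [DecidableEq B] (ρ : Matrix (A × B) (A × B) ℂ) :
    ∑ b : B, partialTraceKraus A b * ρ * (partialTraceKraus A b)ᴴ = partialTraceB ρ := by
  ext a a'
  simp [Matrix.sum_apply, Matrix.mul_apply, partialTraceKraus, partialTraceB, ite_and,
    Fintype.sum_prod_type, apply_ite]

theorem partialTraceB_kronecker_conj {A B : Type*} [Fintype A] [DecidableEq A] [Fintype B]
    [DecidableEq B] (U : Matrix A A ℂ) {V : Matrix B B ℂ} (hV : Vᴴ * V = 1)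
    (ρ : Matrix (A × B) (A × B) ℂ) :
    partialTraceB ((U ⊗ₖ V) * ρ * (U ⊗ₖ V)ᴴ) = U * partialTraceB ρ * Uᴴ := by
  refine Matrix.ext_iff_trace_mul_right.mpr fun M => ?_
  rw [trace_partialTraceB_mul, Matrix.mul_assoc, Matrix.mul_assoc, Matrix.trace_mul_comm,
    Matrix.mul_assoc, Matrix.mul_assoc, Matrix.mul_assoc, Matrix.mul_assoc, Matrix.trace_mul_comm U,
    Matrix.mul_assoc, trace_partialTraceB_mul, Matrix.conjTranspose_kronecker,
    ← Matrix.mul_kronecker_mul, ← Matrix.mul_kronecker_mul, Matrix.one_mul, hV, Matrix.mul_assoc]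

theorem idTensor_dual {A B : Type*} [Fintype A] [DecidableEq A] [Fintype B] [DecidableEq B]
    (Ψ : QuantumChannel B) (K : Matrix A A ℂ) :
    ∑ j, ((Ψ.idTensor A).kraus j)ᴴ * (K ⊗ₖ (1 : Matrix B B ℂ)) * (Ψ.idTensor A).kraus j =
      K ⊗ₖ (1 : Matrix B B ℂ) := by
  have h (j : Fin (Ψ.idTensor A).size) :
      (K ⊗ₖ (1 : Matrix B B ℂ)) * (Ψ.idTensor A).kraus j =
        (Ψ.idTensor A).kraus j * (K ⊗ₖ (1 : Matrix B B ℂ)) := by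
    change (K ⊗ₖ (1 : Matrix B B ℂ)) * ((1 : Matrix A A ℂ) ⊗ₖ Ψ.kraus j) =
      ((1 : Matrix A A ℂ) ⊗ₖ Ψ.kraus j) * (K ⊗ₖ (1 : Matrix B B ℂ))
    simp only [← Matrix.mul_kronecker_mul, Matrix.one_mul, Matrix.mul_one]
  simp only [Matrix.mul_assoc, h]
  simp only [← Matrix.mul_assoc]
  rw [← Finset.sum_mul, (Ψ.idTensor A).complete, Matrix.one_mul]

theorem partialTraceB_idTensor_apply {A B : Type*} [Fintype A] [DecidableEq A] [Fintype B]
    [DecidableEq B] (Ψ : QuantumChannel B) (ρ : Matrix (A × B) (A × B) ℂ) :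
    partialTraceB ((Ψ.idTensor A).apply ρ) = partialTraceB ρ := by
  refine Matrix.ext_iff_trace_mul_right.mpr fun M => ?_
  rw [trace_partialTraceB_mul, trace_partialTraceB_mul, QuantumChannel.apply]
  conv_rhs => rw [← idTensor_dual Ψ M]
  rw [Finset.sum_mul, Finset.mul_sum, Matrix.trace_sum, Matrix.trace_sum]
  refine Finset.sum_congr rfl fun j _ => ?_
  rw [← Matrix.mul_assoc, Matrix.trace_mul_comm _ ((Ψ.idTensor A).kraus j)]
  simp only [Matrix.mul_assoc]

theorem partialTraceB_kronecker {A B : Type*} [Fintype B] (ρ : Matrix A A ℂ) (σ : Matrix B B ℂ) :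
    partialTraceB (ρ ⊗ₖ σ) = σ.trace • ρ := by
  ext a a'
  simp [partialTraceB, Matrix.trace, mul_comm, ← Finset.mul_sum]

/-! ### The correlation quantifier -/

/-- The terms `tr(ρ K† K)` of the two skew informations coincide, since `ρ_A` is the reduced
state. -/
theorem corrQuantifier_eq {A B : Type*} [Fintype A] [DecidableEq A] [Fintype B] [DecidableEq B]
    (α : ℝ) (ρ : Matrix (A × B) (A × B) ℂ) (Φ : QuantumChannel A) :
    corrQuantifier α ρ Φ = ∑ i, (wydForm α (partialTraceB ρ) (Φ.kraus i) -
      wydForm α ρ (Φ.kraus i ⊗ₖ (1 : Matrix B B ℂ))) := by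
  rw [corrQuantifier, skewInfo, skewInfo]
  change (∑ i : Fin Φ.size, skewInfoOp α ρ (Φ.kraus i ⊗ₖ (1 : Matrix B B ℂ))) - _ = _
  rw [← Finset.sum_sub_distrib]
  refine Finset.sum_congr rfl fun i _ => ?_
  rw [skewInfoOp, skewInfoOp, Matrix.mul_assoc (partialTraceB ρ), trace_partialTraceB_mul,
    Matrix.mul_assoc ρ, Matrix.conjTranspose_kronecker, Matrix.conjTranspose_one,
    ← Matrix.mul_kronecker_mul, Matrix.one_mul, wydForm, wydForm, Matrix.conjTranspose_kronecker,
    Matrix.conjTranspose_one, Complex.sub_re, Complex.sub_re]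
  ring

theorem theorem2 {A B : Type*} [Fintype A] [DecidableEq A] [Fintype B] [DecidableEq B]
    (α : ℝ) (hα₀ : 0 < α) (hα₁ : α < 1)
    (ρ : Matrix (A × B) (A × B) ℂ) (hρ : IsDensity ρ) (Φ : QuantumChannel A) :
    (0 ≤ corrQuantifier α ρ Φ ∧
      ∀ (ρA : Matrix A A ℂ) (ρB : Matrix B B ℂ), IsDensity ρA → IsDensity ρB →
        ρ = ρA ⊗ₖ ρB → corrQuantifier α ρ Φ = 0) ∧
    (∀ (U : Matrix.unitaryGroup A ℂ) (V : Matrix.unitaryGroup B ℂ),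
      corrQuantifier α
          (((U : Matrix A A ℂ) ⊗ₖ (V : Matrix B B ℂ)) * ρ *
            ((U : Matrix A A ℂ) ⊗ₖ (V : Matrix B B ℂ))ᴴ) Φ =
        corrQuantifier α ρ (Φ.conj U)) ∧
    (∀ Ψ : QuantumChannel B,
      corrQuantifier α ((QuantumChannel.idTensor A Ψ).apply ρ) Φ ≤ corrQuantifier α ρ Φ) := by
  have hα : α ∈ Ioo (0 : ℝ) 1 := ⟨hα₀, hα₁⟩
  refine ⟨⟨?_, ?_⟩, ?_, ?_⟩
  · rw [corrQuantifier_eq]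
    refine Finset.sum_nonneg fun i _ => sub_nonneg.mpr ?_
    have h := wydForm_dual_le (partialTraceKraus A (B := B)) ?_ hρ.1 hα (Φ.kraus i)
    · rwa [partialTraceKraus_dual, sum_partialTraceKraus] at h
    · have h := partialTraceKraus_dual (B := B) (1 : Matrix A A ℂ)
      simpa only [Matrix.mul_one, Matrix.one_kronecker_one] using h
  · rintro ρA ρB hA hB rfl
    rw [corrQuantifier_eq]
    refine Finset.sum_eq_zero fun i _ => ?_
    rw [partialTraceB_kronecker, hB.2, one_smul, wydForm_kronecker_one α hA.1 hB, sub_self]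
  · intro U V
    have hU : (U : Matrix A A ℂ)ᴴ * (U : Matrix A A ℂ) = 1 := Matrix.mem_unitaryGroup_iff'.mp U.2
    have hV : (V : Matrix B B ℂ)ᴴ * (V : Matrix B B ℂ) = 1 := Matrix.mem_unitaryGroup_iff'.mp V.2
    have hUV : ((U : Matrix A A ℂ) ⊗ₖ (V : Matrix B B ℂ))ᴴ *
        ((U : Matrix A A ℂ) ⊗ₖ (V : Matrix B B ℂ)) = 1 := by
      rw [Matrix.conjTranspose_kronecker, ← Matrix.mul_kronecker_mul, hU, hV,
        Matrix.one_kronecker_one]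
    have hA : (partialTraceB ρ).PosSemidef := by
      rw [← sum_partialTraceKraus]
      exact Matrix.posSemidef_sum _ fun b _ => hρ.1.mul_mul_conjTranspose_same _
    rw [corrQuantifier_eq, corrQuantifier_eq, partialTraceB_kronecker_conj _ hV]
    refine Finset.sum_congr rfl fun i _ => ?_
    rw [wydForm_unitary_conj α hA hU, wydForm_unitary_conj α hρ.1 hUV,
      Matrix.conjTranspose_kronecker, ← Matrix.mul_kronecker_mul, ← Matrix.mul_kronecker_mul,
      Matrix.mul_one, hV]
    rfl
  · intro Ψ
    rw [corrQuantifier_eq, corrQuantifier_eq, partialTraceB_idTensor_apply]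
    refine Finset.sum_le_sum fun i _ => sub_le_sub_left ?_ _
    have h := wydForm_dual_le (Ψ.idTensor A).kraus (Ψ.idTensor A).complete hρ.1 hα
      (Φ.kraus i ⊗ₖ (1 : Matrix B B ℂ))
    rwa [idTensor_dual] at h
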